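/- **Theorem.** All graphs are finite and simple; the order of a graph is its number of vertices, its size is its number of edges, and equality of graphs means isomorphism. A graph is hamiltonian-connected if any two distinct vertices are joined by a path containing all vertices of the graph, and nonhamiltonian-connected otherwise. $G\vee H$ is the join, $G+H$ the disjoint union, and $\overline{G}$ the complement. Let $n,\delta$ be integers with $3\le\delta\le\lfloor n/2\rfloor$. Let $F(n,\delta)=K_\delta\vee(K_{n-2\delta+1}+\overline{K_{\delta-1}})$. With $t=\lfloor n/2\rfloor$, let $G(n,\delta)$ be the graph obtained from $K_t\vee(K_{n-2t+1}+\overline{K_{t-1}})$ by deleting $t-\delta$ edges that are incident to one common vertex of $\overline{K_{t-1}}$. Let $\varphi(n,\delta)$ be the maximum size of a nonhamiltonian-connected graph of order $n$ and minimum degree $\delta$ (this maximum exists). Then $$ \varphi(n,\delta)=\begin{cases} \binom{n-\delta+1}{2}+\delta(\delta-1) & \text{if } n \text{ is odd and } 3\le\delta\le\frac{n+13}{6}, \text{ or } n \text{ is even and } 3\le\delta\le\frac{n+10}{6},\\[2pt] \frac{3n^2-8n+13}{8}+\delta & \text{if } n \text{ is odd and } \frac{n+13}{6}\le\delta\le\frac{n-1}{2},\\[2pt]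 \frac{3n^2-6n}{8}+\delta & \text{if } n \text{ is even and } \frac{n+10}{6}\le\delta\le\frac{n}{2}. \end{cases} $$ Say that $\varphi(n,\delta)$ is attained by a graph $Q$ if $Q$ is a nonhamiltonian-connected graph of order $n$, minimum degree $\delta$ and size $\varphi(n,\delta)$. 1. If $\delta=\frac{n+13}{6}$ or $\delta=\frac{n+10}{6}$, then $\varphi(n,\delta)$ is attained by $Q$ if and only if $Q=F(n,\delta)$ or $Q=G(n,\delta)$. 2. If $n$ is odd and $3\le\delta\le\frac{n+11}{6}$, or $n$ is even and $3\le\delta\le\frac{n+8}{6}$, then $\varphi(n,\delta)$ is attained by $Q$ if and only if $Q=F(n,\delta)$. 3. If $n$ is odd and $\frac{n+15}{6}\le\delta\le\frac{n-1}{2}$, or $n$ is even and $\frac{n+12}{6}\le\delta\le\frac{n}{2}$, then $\varphi(n,\delta)$ is attained by $Q$ if and only if $Q=G(n,\delta)$. -/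

import Mathlib

namespace HamConn

/-- A graph is hamiltonian-connected if any two distinct vertices are the ends of a
Hamilton path. -/
def IsHamiltonianConnected {V : Type*} [DecidableEq V] (G : SimpleGraph V) : Prop :=
  ∀ u v : V, u ≠ v → ∃ p : G.Walk u v, p.IsHamiltonian

/-- The join of two graphs: their disjoint union, together with all edges between them. -/
def join {V W : Type*} (G : SimpleGraph V) (H : SimpleGraph W) : SimpleGraph (V ⊕ W) :=
  (G ⊕g H) ⊔ completeBipartiteGraph V W

/-- The graph `K_k ∨ (K_{n-2k+1} + complement of K_{k-1})`, meant for `1 ≤ k` and `2 * k ≤ n`;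
it then has `n` vertices. -/
def F (n k : ℕ) : SimpleGraph (Fin k ⊕ (Fin (n - 2 * k + 1) ⊕ Fin (k - 1))) :=
  join (⊤ : SimpleGraph (Fin k))
    ((⊤ : SimpleGraph (Fin (n - 2 * k + 1))) ⊕g (⊥ : SimpleGraph (Fin (k - 1))))

/-- With `t = ⌊n/2⌋`, the graph obtained from `K_t ∨ (K_{n-2t+1} + complement of K_{t-1})` by
deleting `t - d` edges at one vertex of the independent part `complement of K_{t-1}`. All edges at
that vertex lead to `K_t`, so up to isomorphism it does not matter which are deleted: here the ones
joining vertex `0` of the independent part to the vertices `0, …, t - d - 1` of `K_t`. -/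
def G (n d : ℕ) :
    SimpleGraph (Fin (n / 2) ⊕ (Fin (n - 2 * (n / 2) + 1) ⊕ Fin (n / 2 - 1))) :=
  (F n (n / 2)).deleteEdges
    {e | ∃ (a : Fin (n / 2)) (b : Fin (n / 2 - 1)),
      a.val < n / 2 - d ∧ b.val = 0 ∧ e = s(Sum.inl a, Sum.inr (Sum.inr b))}

open scoped Classical in
/-- `Q` is a nonhamiltonian-connected graph of order `n` and minimum degree `d`. -/
def IsAdmissible {V : Type*} [Fintype V] (n d : ℕ) (Q : SimpleGraph V) : Prop :=
  Fintype.card V = n ∧ Q.minDegree = d ∧ ¬ IsHamiltonianConnected Q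

/-- The sizes of the nonhamiltonian-connected graphs of order `n` and minimum degree `d`. -/
def sizes (n d : ℕ) : Set ℕ :=
  {m | ∃ Q : SimpleGraph (Fin n), IsAdmissible n d Q ∧ Q.edgeSet.ncard = m}

/-- The maximum size of a nonhamiltonian-connected graph of order `n` and minimum degree `d`. -/
noncomputable def phi (n d : ℕ) : ℕ := sSup (sizes n d)

/-- The maximum size `phi n d` is attained by the graph `Q`. -/
def Attains {V : Type*} [Fintype V] (n d : ℕ) (Q : SimpleGraph V) : Prop :=
  IsAdmissible n d Q ∧ Q.edgeSet.ncard = phi n d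

end HamConn

/-!
The argument rests on Berge's degree condition, `HamConn.exists_degree_obstruction`: a
nonhamiltonian-connected graph of order `n` and minimum degree `δ` has, for some `k` with
`δ ≤ k ≤ n / 2`, at least `k - 1` vertices of degree at most `k` and at least `n - k` vertices of
degree at most `n - k`. It follows from a Bondy-Chvátal closure lemma: joining two nonadjacent
vertices of degree sum at least `n + 1` does not create hamiltonian-connectedness.

Given such a `k`, choose a set `S` of `k - 1` vertices of degree at most `k` that contains a vertex
of degree `δ`. Counting the edges that meet `S` and those that do not bounds the size by
`(n - k + 1).choose 2 + (k - 2) * k + δ`. Equality forces `S` to be independent, its complement to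
be a clique and, by the second half of Berge's condition, the neighbourhoods of the vertices of `S`
to lie in a single set of `k` vertices, so that the graph is determined up to isomorphism: it is
`K_k ∨ (K_{n-2k+1} + (k-1) K_1)` with `k - δ` edges deleted at one vertex of the independent part
(`HamConn.exists_ncard_edgeSet_le_shapeSize`). Conversely these graphs are admissible
(`HamConn.HasShape.isAdmissible_and_ncard`); for `k = δ` and `k = ⌊n/2⌋` they are `F n δ` and
`G n δ`.

The bound is a strictly convex quadratic in `k`, so only the two ends `k = δ` and `k = ⌊n/2⌋` can
be maximal; the sign of `(⌊n/2⌋ - δ) (2n + 5 - 3 (⌊n/2⌋ + δ))` decides between them.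
-/

namespace HamConn

open SimpleGraph

section

open scoped Classical

variable {V : Type*} [Fintype V]

/-! ### Hamilton paths as enumerations of the vertices -/

/-- `f` enumerates, along a Hamilton path of `Q` from `x` to `y`, the vertices of `Q` as
`f 0, …, f (n - 1)`, where `n` is the order. The values `f i` with `n ≤ i` are irrelevant. -/
structure IsHamEnum (Q : SimpleGraph V) (x y : V) (f : ℕ → V) : Prop where
  zero : f 0 = x
  last : f (Fintype.card V - 1) = y
  inj : Set.InjOn f {i | i < Fintype.card V}
  adj : ∀ i, i + 1 < Fintype.card V → Q.Adj (f i) (f (i + 1))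

lemma exists_index_of_injOn {f : ℕ → V} (hf : Set.InjOn f {i | i < Fintype.card V}) (v : V) :
    ∃ i < Fintype.card V, f i = v := by
  have h := Finset.surjOn_of_injOn_of_card_le (s := Finset.range (Fintype.card V))
    (t := Finset.univ) f (by simp [Set.MapsTo]) (fun a ha b hb => hf (by simpa using ha)
      (by simpa using hb)) (by simp)
  obtain ⟨i, hi, rfl⟩ := h (Finset.mem_coe.2 (Finset.mem_univ v))
  exact ⟨i, by simpa using hi, rfl⟩

lemma exists_walk_support_eq_map {V : Type*} (Q : SimpleGraph V) (f : ℕ → V) (m : ℕ)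
    (h : ∀ i < m, Q.Adj (f i) (f (i + 1))) :
    ∃ p : Q.Walk (f 0) (f m), p.support = (List.range (m + 1)).map f := by
  induction m with
  | zero => exact ⟨Walk.nil, by simp⟩
  | succ m ih =>
    obtain ⟨p, hp⟩ := ih fun i hi => h i (by omega)
    refine ⟨p.concat (h m (by omega)), ?_⟩
    rw [Walk.support_concat, hp, List.range_succ (n := m + 1), List.map_append]
    rfl

lemma exists_isHamiltonian_iff [inst : DecidableEq V] (Q : SimpleGraph V) (x y : V) :
    (∃ p : Q.Walk x y, p.IsHamiltonian) ↔ ∃ f, IsHamEnum Q x y f := by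
  constructor
  · rintro ⟨p, hp⟩
    have hl := hp.length_eq
    have hpos : 0 < Fintype.card V := Fintype.card_pos_iff.2 ⟨x⟩
    refine ⟨p.getVert, p.getVert_zero, hl ▸ p.getVert_length, ?_, ?_⟩
    · intro a ha b hb
      simp only [Set.mem_ofPred_eq] at ha hb
      exact hp.isPath.getVert_injOn (by simp only [Set.mem_ofPred_eq]; omega)
        (by simp only [Set.mem_ofPred_eq]; omega)
    · intro i hi
      exact p.adj_getVert_succ (by omega)
  · rintro ⟨f, rfl, rfl, hinj, hadj⟩
    obtain ⟨p, hp⟩ := exists_walk_support_eq_map Q f (Fintype.card V - 1)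
      fun i hi => hadj i (by omega)
    have hpos : 0 < Fintype.card V := Fintype.card_pos_iff.2 ⟨f 0⟩
    have hn : Fintype.card V - 1 + 1 = Fintype.card V := by omega
    rw [hn] at hp
    refine ⟨p, Walk.IsPath.isHamiltonian_of_mem (Walk.IsPath.mk' ?_) ?_⟩
    · rw [hp]
      refine List.Nodup.map_on (fun a ha b hb => hinj (by simpa using ha) (by simpa using hb))
        List.nodup_range
    · intro w
      obtain ⟨i, hi, rfl⟩ := exists_index_of_injOn hinj w
      rw [hp]
      exact List.mem_map_of_mem (List.mem_range.2 hi)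

lemma isHamiltonianConnected_iff [DecidableEq V] (Q : SimpleGraph V) :
    IsHamiltonianConnected Q ↔ ∀ x y, x ≠ y → ∃ f, IsHamEnum Q x y f := by
  simp only [IsHamiltonianConnected, exists_isHamiltonian_iff]

lemma card_filter_mem_eq_card {f : ℕ → V} (hf : Set.InjOn f {i | i < Fintype.card V})
    (s : Finset V) : ((Finset.range (Fintype.card V)).filter fun i => f i ∈ s).card = s.card := by
  refine Finset.card_bij (fun i _ => f i) ?_ ?_ ?_
  · intro i hi
    exact (Finset.mem_filter.1 hi).2
  · intro a ha b hb
    exact hf (by simpa using (Finset.mem_filter.1 ha).1) (by simpa using (Finset.mem_filter.1 hb).1)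
  · intro w hw
    obtain ⟨i, hi, rfl⟩ := exists_index_of_injOn hf w
    exact ⟨i, by simpa [hi] using hw, rfl⟩

/-! ### The closure lemma -/

/-- A Hamilton path with one defective step `u, v` can be repaired when
`deg u + deg v ≥ n + 1`: by counting, some other step `p, q` has `u ~ p` and `v ~ q`, and
reversing the part of the path between the two steps replaces them by `u, p` and `v, q`. -/
lemma exists_isHamEnum_of_defect (Q : SimpleGraph V) {f : ℕ → V}
    (hf : Set.InjOn f {i | i < Fintype.card V}) {i : ℕ} (hi : i + 1 < Fintype.card V)
    (hadj : ∀ j, j ≠ i → j + 1 < Fintype.card V → Q.Adj (f j) (f (j + 1)))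
    (hdeg : Fintype.card V + 1 ≤ Q.degree (f i) + Q.degree (f (i + 1))) :
    ∃ g, IsHamEnum Q (f 0) (f (Fintype.card V - 1)) g := by
  set n := Fintype.card V with hn
  obtain ⟨j, hj, h1, h2⟩ : ∃ j, j + 1 < n ∧ Q.Adj (f i) (f j) ∧ Q.Adj (f (i + 1)) (f (j + 1)) := by
    by_contra! hcon
    -- The positions following neighbours of `f i`, and the positions of neighbours of `f (i + 1)`,
    -- would be disjoint subsets of `{0, …, n} \ {i + 1}`.
    let A := ((Finset.range n).filter fun j => Q.Adj (f i) (f j)).image (· + 1)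
    let B := (Finset.range n).filter fun j => Q.Adj (f (i + 1)) (f j)
    have hA : A.card = Q.degree (f i) := by
      rw [Finset.card_image_of_injective _ (add_left_injective 1)]
      simpa using card_filter_mem_eq_card hf (Q.neighborFinset (f i))
    have hB : B.card = Q.degree (f (i + 1)) := by
      simpa [B] using card_filter_mem_eq_card hf (Q.neighborFinset (f (i + 1)))
    have hAB : Disjoint A B := by
      rw [Finset.disjoint_left]
      intro x hx hx'
      obtain ⟨j, hj, rfl⟩ := Finset.mem_image.1 hx
      simp only [Finset.mem_filter, Finset.mem_range, B] at hj hx'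
      exact hcon j hx'.1 hj.2 hx'.2
    have hsub : A ∪ B ⊆ (Finset.range (n + 1)).erase (i + 1) := by
      intro x hx
      rcases Finset.mem_union.1 hx with hx | hx
      · obtain ⟨j, hj, rfl⟩ := Finset.mem_image.1 hx
        simp only [Finset.mem_filter, Finset.mem_range] at hj
        simp only [Finset.mem_erase, Finset.mem_range]
        refine ⟨?_, by omega⟩
        intro h
        obtain rfl : j = i := by omega
        exact Q.loopless.irrefl _ hj.2
      · simp only [Finset.mem_filter, Finset.mem_range, B] at hx
        simp only [Finset.mem_erase, Finset.mem_range]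
        refine ⟨?_, by omega⟩
        rintro rfl
        exact Q.loopless.irrefl _ hx.2
    have := Finset.card_le_card hsub
    rw [Finset.card_union_of_disjoint hAB, hA, hB, Finset.card_erase_of_mem (by simp; omega),
      Finset.card_range] at this
    omega
  obtain ⟨a, b, hab, hb, hia, h1, h2⟩ : ∃ a b, a < b ∧ b + 1 < n ∧ (i = a ∨ i = b) ∧
      Q.Adj (f a) (f b) ∧ Q.Adj (f (a + 1)) (f (b + 1)) := by
    rcases lt_trichotomy i j with h | rfl | h
    · exact ⟨i, j, h, hj, Or.inl rfl, h1, h2⟩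
    · exact absurd h1 (Q.loopless.irrefl _)
    · exact ⟨j, i, h, hi, Or.inr rfl, h1.symm, h2.symm⟩
  let σ : ℕ → ℕ := fun k => if a < k ∧ k ≤ b then a + b + 1 - k else k
  have σin : ∀ k, a < k → k ≤ b → σ k = a + b + 1 - k := fun k h h' => if_pos ⟨h, h'⟩
  have σout : ∀ k, k ≤ a ∨ b < k → σ k = k := fun k h => if_neg (by omega)
  refine ⟨f ∘ σ, by simp [σ], ?_, ?_, ?_⟩
  · simp only [Function.comp]
    rw [σout _ (by omega)]
  · have hlt : ∀ k < n, σ k < n := by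
      intro k hk
      by_cases h : a < k ∧ k ≤ b
      · rw [σin k h.1 h.2]; omega
      · rw [σout k (by omega)]; omega
    intro k hk l hl hkl
    simp only [Set.mem_ofPred_eq] at hk hl
    have h := hf (hlt k hk) (hlt l hl) hkl
    by_cases hk' : a < k ∧ k ≤ b <;> by_cases hl' : a < l ∧ l ≤ b
    · rw [σin k hk'.1 hk'.2, σin l hl'.1 hl'.2] at h; omega
    · rw [σin k hk'.1 hk'.2, σout l (by omega)] at h; omega
    · rw [σout k (by omega), σin l hl'.1 hl'.2] at h; omega
    · rwa [σout k (by omega), σout l (by omega)] at h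
  · intro k hk
    simp only [Function.comp]
    rcases lt_trichotomy k a with h | rfl | h
    · rw [σout k (by omega), σout (k + 1) (by omega)]
      exact hadj k (by omega) hk
    · rw [σout k (by omega), σin (k + 1) (by omega) (by omega)]
      simpa using (show k + b + 1 - (k + 1) = b by omega) ▸ h1
    rcases lt_trichotomy k b with h' | rfl | h'
    · rw [σin k (by omega) (by omega), σin (k + 1) (by omega) (by omega)]
      have := (hadj (a + b - k) (by omega) (by omega)).symm
      rwa [show a + b + 1 - k = a + b - k + 1 by omega,
        show a + b + 1 - (k + 1) = a + b - k by omega]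
    · rw [σin k (by omega) (by omega), σout (k + 1) (by omega),
        show a + k + 1 - k = a + 1 by omega]
      exact h2
    · rw [σout k (by omega), σout (k + 1) (by omega)]
      exact hadj k (by omega) hk

/-- Joining two nonadjacent vertices whose degrees sum to at least `n + 1` does not create
hamiltonian-connectedness. -/
lemma isHamiltonianConnected_of_sup_edge (Q : SimpleGraph V) {u v : V}
    (hdeg : Fintype.card V + 1 ≤ Q.degree u + Q.degree v)
    (h : IsHamiltonianConnected (Q ⊔ edge u v)) : IsHamiltonianConnected Q := by
  rw [isHamiltonianConnected_iff] at h ⊢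
  intro x y hxy
  obtain ⟨f, rfl, rfl, hinj, hadj⟩ := h x y hxy
  by_cases hall : ∀ i, i + 1 < Fintype.card V → Q.Adj (f i) (f (i + 1))
  · exact ⟨f, rfl, rfl, hinj, hall⟩
  push Not at hall
  obtain ⟨i, hi, hna⟩ := hall
  have key : ∀ j, j + 1 < Fintype.card V → ¬ Q.Adj (f j) (f (j + 1)) →
      (f j = u ∧ f (j + 1) = v ∨ f j = v ∧ f (j + 1) = u) := by
    intro j hj hn
    have := hadj j hj
    rw [sup_adj, edge_adj] at this
    tauto
  have hi' := key i hi hna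
  refine exists_isHamEnum_of_defect Q hinj hi ?_ ?_
  · intro j hji hj
    by_contra hn
    have hj' := key j hj hn
    have e1 : f j = f i → j = i := fun h => hinj (by simp; omega) (by simp; omega) h
    have e2 : f j = f (i + 1) → j = i + 1 := fun h => hinj (by simp; omega) (by simp; omega) h
    have e3 : f (j + 1) = f i → j + 1 = i := fun h => hinj (by simp; omega) (by simp; omega) h
    have h2 : f j = f i ∨ (f j = f (i + 1) ∧ f (j + 1) = f i) := by
      rcases hi' with ⟨p, q⟩ | ⟨p, q⟩ <;> rcases hj' with ⟨r, s⟩ | ⟨r, s⟩ <;> simp [p, q, r, s]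
    rcases h2 with h2 | ⟨h2, h3⟩
    · exact hji (e1 h2)
    · have := e2 h2
      have := e3 h3
      omega
  · rcases hi' with ⟨p, q⟩ | ⟨p, q⟩ <;> rw [p, q] <;> omega

lemma isHamiltonianConnected_top : IsHamiltonianConnected (⊤ : SimpleGraph V) := by
  rw [isHamiltonianConnected_iff]
  intro x y hxy
  have hcard : 1 < Fintype.card V := Fintype.one_lt_card_iff.2 ⟨x, y, hxy⟩
  obtain ⟨n, hn⟩ : ∃ n, Fintype.card V = n + 2 := ⟨Fintype.card V - 2, by omega⟩
  let e₀ := Fintype.equivFinOfCardEq hn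
  -- Move `x` to position `0`, and then `y` to the last position.
  let e₁ := e₀.trans (Equiv.swap (e₀ x) 0)
  let e := e₁.trans (Equiv.swap (e₁ y) (Fin.last (n + 1)))
  have hx₁ : e₁ x = 0 := by simp [e₁]
  have hx : e x = 0 := by
    change Equiv.swap (e₁ y) (Fin.last (n + 1)) (e₁ x) = 0
    rw [hx₁, Equiv.swap_apply_of_ne_of_ne]
    · rw [← hx₁]
      exact e₁.injective.ne hxy
    · exact (Fin.last_pos).ne
  have hy : e y = Fin.last (n + 1) := by simp [e]
  let f : ℕ → V := fun i => e.symm (Fin.ofNat (n + 2) i)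
  have hinj : Set.InjOn f {i | i < Fintype.card V} := by
    intro a ha b hb hab
    simp only [Set.mem_ofPred_eq, hn] at ha hb
    have := congrArg Fin.val (e.symm.injective hab)
    simpa [Fin.ofNat, Nat.mod_eq_of_lt ha, Nat.mod_eq_of_lt hb] using this
  refine ⟨f, ?_, ?_, hinj, ?_⟩
  · change e.symm (Fin.ofNat (n + 2) 0) = x
    rw [Equiv.symm_apply_eq, hx]
    rfl
  · change e.symm (Fin.ofNat (n + 2) (Fintype.card V - 1)) = y
    rw [Equiv.symm_apply_eq, hy, hn]
    ext
    simp [Fin.ofNat]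
  · intro i hi
    rw [top_adj]
    intro h
    have := hinj (by simp; omega) (by simpa using hi) h
    omega

/-- Berge's degree condition (the analogue of Chvátal's theorem for hamiltonian-connectedness).
In a maximal nonhamiltonian-connected supergraph take nonadjacent `u`, `v` with
`deg u ≤ deg v` and `deg u + deg v` maximal; then `k = deg u` does it. -/
lemma exists_degree_obstruction (Q : SimpleGraph V) (hQ : ¬ IsHamiltonianConnected Q) :
    ∃ k, Q.minDegree ≤ k ∧ 2 * k ≤ Fintype.card V ∧
      k ≤ (Finset.univ.filter fun v => Q.degree v ≤ k).card + 1 ∧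
      Fintype.card V - k ≤ (Finset.univ.filter fun v => Q.degree v ≤ Fintype.card V - k).card := by
  obtain ⟨H, hQH, hH⟩ := Finite.exists_le_maximal (p := fun H => ¬ IsHamiltonianConnected H) hQ
  have hore : ∀ u v, u ≠ v → ¬ H.Adj u v → H.degree u + H.degree v ≤ Fintype.card V := by
    intro u v huv hadj
    by_contra hcon
    have hlt : H < H ⊔ edge u v := by
      refine lt_of_le_of_ne le_sup_left fun h => hadj ?_
      rw [h, sup_adj, edge_adj]
      exact Or.inr ⟨Or.inl ⟨rfl, rfl⟩, huv⟩
    refine hH.prop (isHamiltonianConnected_of_sup_edge H (u := u) (v := v) (by omega) ?_)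
    by_contra hn
    exact hlt.not_ge (hH.le_of_ge hn hlt.le)
  let N : Finset (V × V) := Finset.univ.filter fun p => p.1 ≠ p.2 ∧ ¬ H.Adj p.1 p.2
  have hN : N.Nonempty := by
    by_contra hne
    refine hH.prop ?_
    have : H = ⊤ := by
      ext u v
      rw [top_adj]
      refine ⟨fun h => h.ne, fun h => ?_⟩
      by_contra hadj
      exact hne ⟨(u, v), by simp [N, h, hadj]⟩
    rw [this]
    exact isHamiltonianConnected_top
  obtain ⟨⟨u, v⟩, huvN, hmax⟩ := N.exists_max_image (fun p => H.degree p.1 + H.degree p.2) hN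
  simp only [N, Finset.mem_filter, Finset.mem_univ, true_and, Prod.forall] at huvN hmax
  obtain ⟨u, v, huv, hadj, hmax, hle⟩ : ∃ u v, u ≠ v ∧ ¬ H.Adj u v ∧
      (∀ a b, a ≠ b ∧ ¬ H.Adj a b → H.degree a + H.degree b ≤ H.degree u + H.degree v) ∧
      H.degree u ≤ H.degree v := by
    rcases le_total (H.degree u) (H.degree v) with h | h
    · exact ⟨u, v, huvN.1, huvN.2, hmax, h⟩
    · exact ⟨v, u, huvN.1.symm, fun h => huvN.2 h.symm,
        fun a b hab => (hmax a b hab).trans (add_comm _ _).le, h⟩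
  have hsum := hore u v huv hadj
  have hdeg : ∀ w, Q.degree w ≤ H.degree w := fun w => degree_le_of_le hQH
  have hnon : ∀ w, (Finset.univ.filter fun a => a ≠ w ∧ ¬ H.Adj w a).card + H.degree w + 1 =
      Fintype.card V := by
    intro w
    have h := H.degree_compl w
    have h2 := H.degree_lt_card_verts w
    rw [← card_neighborFinset_eq_degree, neighborFinset_eq_filter] at h
    have h3 : (Finset.univ.filter fun a => Hᶜ.Adj w a) =
        Finset.univ.filter fun a => a ≠ w ∧ ¬ H.Adj w a := by
      ext a
      simp [ne_comm]
    rw [h3] at h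
    omega
  refine ⟨H.degree u, (Q.minDegree_le_degree u).trans (hdeg u), by omega, ?_, ?_⟩
  · have hsub : (Finset.univ.filter fun a => a ≠ v ∧ ¬ H.Adj v a) ⊆
        Finset.univ.filter fun w => Q.degree w ≤ H.degree u := by
      intro a ha
      simp only [Finset.mem_filter, Finset.mem_univ, true_and] at ha ⊢
      have := hmax a v ⟨ha.1, fun h => ha.2 h.symm⟩
      have := hdeg a
      omega
    have := Finset.card_le_card hsub
    have := hnon v
    omega
  · have hsub : insert u (Finset.univ.filter fun a => a ≠ u ∧ ¬ H.Adj u a) ⊆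
        Finset.univ.filter fun w => Q.degree w ≤ Fintype.card V - H.degree u := by
      intro a ha
      rcases Finset.mem_insert.1 ha with rfl | ha
      · simp only [Finset.mem_filter, Finset.mem_univ, true_and]
        have := hdeg a
        omega
      simp only [Finset.mem_filter, Finset.mem_univ, true_and] at ha ⊢
      have := hmax u a ⟨ha.1.symm, ha.2⟩
      have := hdeg a
      omega
    have := Finset.card_le_card hsub
    rw [Finset.card_insert_of_notMem (by simp)] at this
    have := hnon u
    omega

/-! ### The shape of the extremal graphs -/

/-- The five kinds of vertices in `F n k` and its relatives, where `K_k ∨ (K_{n-2k+1} + (k-1) K_1)`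
has lost some edges at one vertex of its independent part: that vertex (`special`), the other
vertices of the independent part (`indep`), the vertices of `K_k` that are adjacent to the special
vertex (`near`) and those that are not (`far`), and the vertices of `K_{n-2k+1}` (`rest`). -/
inductive Part
  | special
  | indep
  | near
  | far
  | rest

/-- Whether distinct vertices of the given kinds are adjacent. -/
def Part.Joined : Part → Part → Prop
  | special, near | near, special => True
  | indep, near | near, indep | indep, far | far, indep => True
  | special, _ | _, special | indep, _ | _, indep => False
  | _, _ => True

/-- The number of vertices of each kind, for order `n` and special vertex of degree `d`. -/
def Part.size (n k d : ℕ) : Part → ℕ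
  | special => 1
  | indep => k - 2
  | near => d
  | far => k - d
  | rest => n - 2 * k + 1

/-- `Q` is, up to isomorphism, the graph obtained from `K_k ∨ (K_{n-2k+1} + (k-1) K_1)` by deleting
`k - d` edges at one vertex of the independent part, given by a labelling of its vertices with
their kinds. -/
def HasShape {V : Type*} [Fintype V] (n k d : ℕ) (Q : SimpleGraph V) : Prop :=
  ∃ l : V → Part, (∀ a b, Q.Adj a b ↔ a ≠ b ∧ (l a).Joined (l b)) ∧
    ∀ p, (Finset.univ.filter fun a => l a = p).card = p.size n k d

variable {W : Type*} [Fintype W]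

lemma HasShape.nonempty_iso {n k d : ℕ} {Q : SimpleGraph V} {H : SimpleGraph W}
    (hQ : HasShape n k d Q) (hH : HasShape n k d H) : Nonempty (Q ≃g H) := by
  obtain ⟨l, hl, hlc⟩ := hQ
  obtain ⟨m, hm, hmc⟩ := hH
  have e : ∀ p, Nonempty ({a // l a = p} ≃ {b // m b = p}) := fun p => by
    rw [← Fintype.card_eq, Fintype.card_subtype, Fintype.card_subtype, hlc, hmc]
  have hφ := Equiv.ofFiberEquiv_map fun p => (e p).some
  refine ⟨⟨Equiv.ofFiberEquiv fun p => (e p).some, ?_⟩⟩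
  intro a b
  rw [hl, hm, hφ, hφ]
  exact and_congr_left' (Equiv.injective _).ne_iff

lemma HasShape.of_iso {n k d : ℕ} {Q : SimpleGraph V} {H : SimpleGraph W}
    (hH : HasShape n k d H) (e : Q ≃g H) : HasShape n k d Q := by
  obtain ⟨m, hm, hmc⟩ := hH
  refine ⟨m ∘ e, ?_, ?_⟩
  · intro a b
    rw [← e.map_adj_iff, hm]
    simp
  · intro p
    rw [← hmc p]
    exact Finset.card_equiv e.toEquiv (by simp)

lemma sum_ite_label_eq {m c : ℕ} (hc : c ≤ m) {l : Fin m → Part} {p q : Part}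
    (hl : ∀ i, l i = if i.val < c then p else q) (r : Part) :
    (∑ i, if l i = r then 1 else 0) = (if p = r then c else 0) + if q = r then m - c else 0 := by
  obtain ⟨e, rfl⟩ := Nat.exists_eq_add_of_le hc
  rw [Fin.sum_univ_add]
  simp [hl]

lemma hasShape_G (n d : ℕ) (hd : 2 ≤ d) (hdn : d ≤ n / 2) : HasShape n (n / 2) d (G n d) := by
  let l : Fin (n / 2) ⊕ (Fin (n - 2 * (n / 2) + 1) ⊕ Fin (n / 2 - 1)) → Part :=
    Sum.elim (fun a => if a.val < n / 2 - d then .far else .near)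
      (Sum.elim (fun _ => .rest) fun b => if b.val < 1 then .special else .indep)
  refine ⟨l, ?_, ?_⟩
  · rintro (a | a | a) (b | b | b) <;>
      simp only [G, F, join, l, deleteEdges_adj, sup_adj] <;>
      simp <;> (try split_ifs) <;> simp_all [Part.Joined]
  · intro p
    rw [Finset.card_filter, Fintype.sum_sum_type, Fintype.sum_sum_type]
    have h₁ := sum_ite_label_eq (c := n / 2 - d) (by omega) (l := fun a => l (.inl a))
      (fun _ => rfl) p
    have h₂ := sum_ite_label_eq (c := 0) (by omega) (l := fun a => l (.inr (.inl a)))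
      (p := .rest) (q := .rest) (fun _ => by simp [l]) p
    have h₃ := sum_ite_label_eq (c := 1) (by omega) (l := fun a => l (.inr (.inr a)))
      (fun _ => rfl) p
    rw [h₁, h₂, h₃]
    cases p <;> simp [Part.size] <;> omega

lemma hasShape_F (n k : ℕ) (hk : 2 ≤ k) : HasShape n k k (F n k) := by
  let l : Fin k ⊕ (Fin (n - 2 * k + 1) ⊕ Fin (k - 1)) → Part :=
    Sum.elim (fun _ => .near)
      (Sum.elim (fun _ => .rest) fun b => if b.val < 1 then .special else .indep)
  refine ⟨l, ?_, ?_⟩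
  · rintro (a | a | a) (b | b | b) <;>
      simp only [F, join, l, sup_adj] <;>
      simp <;> (try split_ifs) <;> simp_all [Part.Joined]
  · intro p
    rw [Finset.card_filter, Fintype.sum_sum_type, Fintype.sum_sum_type]
    have h₁ := sum_ite_label_eq (c := 0) (by omega) (l := fun a => l (.inl a))
      (p := .near) (q := .near) (fun _ => by simp [l]) p
    have h₂ := sum_ite_label_eq (c := 0) (by omega) (l := fun a => l (.inr (.inl a)))
      (p := .rest) (q := .rest) (fun _ => by simp [l]) p
    have h₃ := sum_ite_label_eq (c := 1) (by omega) (l := fun a => l (.inr (.inr a)))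
      (fun _ => rfl) p
    rw [h₁, h₂, h₃]
    cases p <;> simp [Part.size]
    omega

/-! ### Counting edges along a set of vertices -/

lemma degree_eq_card_add_card_compl (Q : SimpleGraph V) (S : Finset V) (v : V) :
    Q.degree v = (S.filter (Q.Adj v)).card + (Sᶜ.filter (Q.Adj v)).card := by
  rw [← card_neighborFinset_eq_degree, neighborFinset_eq_filter,
    ← Finset.card_union_of_disjoint (Finset.disjoint_filter_filter disjoint_compl_right),
    ← Finset.filter_union, Finset.union_compl]

/-- The edges meeting `S` are counted by the degrees in `S`, those inside `S` twice; the edges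
outside `S` by the degrees in the subgraph induced on the complement of `S`. -/
lemma two_mul_ncard_edgeSet_add (Q : SimpleGraph V) (S : Finset V) :
    2 * Q.edgeSet.ncard + ∑ v ∈ S, (S.filter (Q.Adj v)).card =
      2 * ∑ v ∈ S, Q.degree v + ∑ v ∈ Sᶜ, (Sᶜ.filter (Q.Adj v)).card := by
  have hE : Q.edgeSet.ncard = Q.edgeFinset.card := by
    rw [Set.ncard_eq_toFinset_card']
    rfl
  have hcross : ∑ v ∈ S, (Sᶜ.filter (Q.Adj v)).card = ∑ v ∈ Sᶜ, (S.filter (Q.Adj v)).card := by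
    have := Finset.sum_card_bipartiteAbove_eq_sum_card_bipartiteBelow Q.Adj (s := S) (t := Sᶜ)
    simpa only [Finset.bipartiteAbove, Finset.bipartiteBelow, Q.adj_comm] using this
  have h1 : ∑ v ∈ S, Q.degree v =
      ∑ v ∈ S, (S.filter (Q.Adj v)).card + ∑ v ∈ S, (Sᶜ.filter (Q.Adj v)).card := by
    rw [← Finset.sum_add_distrib]
    exact Finset.sum_congr rfl fun v _ => degree_eq_card_add_card_compl Q S v
  have h2 : ∑ v ∈ Sᶜ, Q.degree v =
      ∑ v ∈ Sᶜ, (S.filter (Q.Adj v)).card + ∑ v ∈ Sᶜ, (Sᶜ.filter (Q.Adj v)).card := by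
    rw [← Finset.sum_add_distrib]
    exact Finset.sum_congr rfl fun v _ => degree_eq_card_add_card_compl Q S v
  have h3 := Q.sum_degrees_eq_twice_card_edges
  rw [← Finset.sum_add_sum_compl S] at h3
  omega

/-- The size of the graphs of shape `(n, k, d)`: a complete graph on `n - k + 1` vertices, `k - 2`
further vertices of degree `k` and one of degree `d`. -/
def shapeSize (n k d : ℕ) : ℕ := (n - k + 1).choose 2 + (k - 2) * k + d

lemma two_mul_shapeSize (n k d : ℕ) :
    2 * shapeSize n k d = (n - k + 1) * (n - k) + 2 * ((k - 2) * k + d) := by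
  have := Nat.choose_two_right (n - k + 1)
  have h2 := Nat.div_mul_cancel (Nat.even_mul_pred_self (n - k + 1)).two_dvd
  rw [← this, Nat.add_sub_cancel] at h2
  unfold shapeSize
  omega

/-! ### Graphs of the given shape are admissible -/

/-- If the vertices of `I` have all their neighbours in `K`, where `|K| ≤ |I| + 1` and
`K ∪ I` is not everything, then no Hamilton path joins two vertices of `K`: on such a path the
successors of the vertices in `I` use up all of `K` but the first vertex, and nothing is left to
follow the last vertex outside `K ∪ I`. -/
lemma not_isHamiltonianConnected_of_subset (Q : SimpleGraph V) (K I : Finset V)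
    (hKI : Disjoint K I) (hcard : K.card ≤ I.card + 1) (hK : 2 ≤ K.card)
    (hadj : ∀ a ∈ I, ∀ b, Q.Adj a b → b ∈ K) (r : V) (hrK : r ∉ K) (hrI : r ∉ I) :
    ¬ IsHamiltonianConnected Q := by
  rw [isHamiltonianConnected_iff]
  intro h
  obtain ⟨x, hx, y, hy, hxy⟩ := Finset.one_lt_card.1 hK
  obtain ⟨f, hf0, hf1, hinj, hf⟩ := h x y hxy
  set n := Fintype.card V with hn
  let KP := (Finset.range n).filter fun i => f i ∈ K
  let IP := (Finset.range n).filter fun i => f i ∈ I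
  have hnpos : 0 < n := Fintype.card_pos_iff.2 ⟨r⟩
  have hsucc : ∀ i < n, f i ∉ K → i + 1 < n := by
    intro i hi hiK
    by_contra hcon
    obtain rfl : i = n - 1 := by omega
    exact hiK (hf1 ▸ hy)
  have himage : IP.image (· + 1) ⊆ KP.erase 0 := by
    intro j hj
    obtain ⟨i, hi, rfl⟩ := Finset.mem_image.1 hj
    simp only [IP, KP, Finset.mem_filter, Finset.mem_range, Finset.mem_erase] at hi ⊢
    have hi' := hsucc i hi.1 fun h => Finset.disjoint_left.1 hKI h hi.2
    exact ⟨by omega, hi', hadj _ hi.2 _ (hf i hi')⟩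
  have heq : IP.image (· + 1) = KP.erase 0 := by
    refine Finset.eq_of_subset_of_card_le himage ?_
    have h1 : IP.card = I.card := card_filter_mem_eq_card hinj I
    have h2 : KP.card = K.card := card_filter_mem_eq_card hinj K
    rw [Finset.card_image_of_injective _ (add_left_injective 1), Finset.card_erase_of_mem]
    · omega
    · simp [KP, hnpos, hf0, hx]
  let R := (Finset.range n).filter fun i => f i ∉ K ∧ f i ∉ I
  have hR : R.Nonempty := by
    obtain ⟨i, hi, rfl⟩ := exists_index_of_injOn hinj r
    exact ⟨i, by simp only [R, Finset.mem_filter, Finset.mem_range]; exact ⟨hi, hrK, hrI⟩⟩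
  obtain ⟨m, hm, hmax⟩ := R.exists_max_image id hR
  simp only [R, Finset.mem_filter, Finset.mem_range, id] at hm hmax
  have hm' := hsucc m hm.1 hm.2.1
  have hmI : f (m + 1) ∉ I := fun h => hm.2.1 (hadj _ h _ (hf m hm').symm)
  have hmK : f (m + 1) ∈ K := by
    by_contra hcon
    have := hmax (m + 1) ⟨hm', hcon, hmI⟩
    omega
  have : m + 1 ∈ IP.image (· + 1) := by
    rw [heq]
    simp [KP, hm', hmK]
  obtain ⟨j, hj, hjm⟩ := Finset.mem_image.1 this
  obtain rfl : j = m := by simpa using hjm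
  exact hm.2.2 (Finset.mem_filter.1 hj).2

variable {n k d : ℕ} {Q : SimpleGraph V}

lemma card_filter_or {l : V → Part} {p q : Part} (hpq : p ≠ q) :
    (Finset.univ.filter fun a => l a = p ∨ l a = q).card =
      (Finset.univ.filter fun a => l a = p).card + (Finset.univ.filter fun a => l a = q).card := by
  rw [Finset.filter_or, Finset.card_union_of_disjoint]
  exact Finset.disjoint_filter.2 fun a _ h h' => hpq (h ▸ h')

lemma HasShape.card_eq (h : HasShape n k d Q) (hdk : d ≤ k) (hk : 2 ≤ k) (hkn : 2 * k ≤ n) :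
    Fintype.card V = n := by
  obtain ⟨l, -, hc⟩ := h
  have hI := card_filter_or (l := l) (p := .special) (q := .indep) (by simp)
  have hK := card_filter_or (l := l) (p := .near) (q := .far) (by simp)
  have hU : (Finset.univ : Finset V) = ((Finset.univ.filter fun a => l a = .special ∨ l a = .indep) ∪
      (Finset.univ.filter fun a => l a = .near ∨ l a = .far)) ∪
      Finset.univ.filter fun a => l a = .rest := by
    ext a
    cases h : l a <;> simp [h]
  rw [← Finset.card_univ, hU, Finset.card_union_of_disjoint, Finset.card_union_of_disjoint, hI, hK,
    hc, hc, hc, hc, hc]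
  · simp only [Part.size]
    omega
  · rw [Finset.disjoint_filter]
    intro a _
    cases h : l a <;> simp
  · rw [Finset.disjoint_left]
    intro a
    cases h : l a <;> simp [h]

lemma HasShape.isAdmissible_and_ncard (h : HasShape n k d Q) (hdk : d ≤ k) (hk : 2 ≤ k)
    (hkn : 2 * k ≤ n) : IsAdmissible n d Q ∧ Q.edgeSet.ncard = shapeSize n k d := by
  have hV := h.card_eq hdk hk hkn
  obtain ⟨l, hl, hc⟩ := h
  let I := Finset.univ.filter fun a => l a = .special ∨ l a = .indep
  let K := Finset.univ.filter fun a => l a = .near ∨ l a = .far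
  have hI : I.card = k - 1 := by
    rw [card_filter_or (by simp), hc, hc]
    simp only [Part.size]
    omega
  have hK : K.card = k := by
    rw [card_filter_or (by simp), hc, hc]
    simp only [Part.size]
    omega
  have hIc : Iᶜ.card = n - k + 1 := by
    rw [Finset.card_compl, hI]
    omega
  have hspecial : ∀ v, l v = .special → Q.degree v = d := by
    intro v hv
    rw [← card_neighborFinset_eq_degree, neighborFinset_eq_filter]
    refine Eq.trans (congrArg Finset.card ?_) (hc .near)
    ext a
    simp only [Finset.mem_filter, Finset.mem_univ, true_and, hl, hv]
    constructor
    · cases h : l a <;> simp [Part.Joined]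
    · intro h
      refine ⟨?_, by simp [h, Part.Joined]⟩
      rintro rfl
      simp [hv] at h
  have hindep : ∀ v, l v = .indep → Q.degree v = k := by
    intro v hv
    rw [← card_neighborFinset_eq_degree, neighborFinset_eq_filter]
    refine Eq.trans (congrArg Finset.card ?_) hK
    ext a
    simp only [Finset.mem_filter, Finset.mem_univ, true_and, hl, hv, K]
    constructor
    · cases h : l a <;> simp [Part.Joined]
    · intro h
      refine ⟨?_, by rcases h with h | h <;> simp [h, Part.Joined]⟩
      rintro rfl
      simp [hv] at h
  have hclique : ∀ v ∈ Iᶜ, Iᶜ.filter (Q.Adj v) = Iᶜ.erase v := by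
    intro v hv
    ext a
    simp only [I, Finset.mem_compl, Finset.mem_filter, Finset.mem_univ, true_and, hl,
      Finset.mem_erase] at hv ⊢
    rw [ne_comm (a := v)]
    cases l a <;> cases h : l v <;> simp [h, Part.Joined] at hv ⊢
  have hcliqueCard : ∀ v ∈ Iᶜ, (Iᶜ.filter (Q.Adj v)).card = n - k := by
    intro v hv
    rw [hclique v hv, Finset.card_erase_of_mem hv, hIc]
    omega
  have hindepSet : ∀ v ∈ I, I.filter (Q.Adj v) = ∅ := by
    intro v hv
    rw [Finset.filter_eq_empty_iff]
    intro a ha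
    simp only [I, Finset.mem_filter, Finset.mem_univ, true_and, hl] at hv ha ⊢
    rcases hv with hv | hv <;> rcases ha with ha | ha <;> simp [hv, ha, Part.Joined]
  obtain ⟨v₀, hv₀⟩ : ∃ v₀, (Finset.univ.filter fun a => l a = .special) = {v₀} :=
    Finset.card_eq_one.1 (hc .special)
  have hv₀' : l v₀ = .special := by
    have : v₀ ∈ Finset.univ.filter fun a => l a = .special := by simp [hv₀]
    simpa using this
  refine ⟨⟨hV, ?_, ?_⟩, ?_⟩
  · have : Nonempty V := ⟨v₀⟩
    refine le_antisymm ((Q.minDegree_le_degree v₀).trans (hspecial v₀ hv₀').le) ?_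
    refine Q.le_minDegree_of_forall_le_degree d fun v => ?_
    by_cases hv : v ∈ I
    · rcases (Finset.mem_filter.1 hv).2 with hv | hv
      · rw [hspecial v hv]
      · rw [hindep v hv]
        exact hdk
    · have h1 := degree_eq_card_add_card_compl Q I v
      have h2 := hcliqueCard v (Finset.mem_compl.2 hv)
      omega
  · obtain ⟨r, hr⟩ : (Finset.univ.filter fun a => l a = .rest).Nonempty := by
      rw [← Finset.card_pos, hc]
      simp [Part.size]
    have hr : l r = .rest := by simpa using hr
    refine not_isHamiltonianConnected_of_subset Q K I ?_ (by omega) (by omega) ?_ r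
      (by simp [K, hr]) (by simp [I, hr])
    · rw [Finset.disjoint_filter]
      intro a _
      cases h : l a <;> simp
    · intro a ha b hab
      simp only [I, K, Finset.mem_filter, Finset.mem_univ, true_and] at ha ⊢
      rw [hl] at hab
      cases h : l b <;> rcases ha with ha | ha <;> simp [ha, h, Part.Joined] at hab ⊢
  · have h1 := two_mul_ncard_edgeSet_add Q I
    rw [Finset.sum_congr rfl hcliqueCard, Finset.sum_const, hIc,
      Finset.sum_congr rfl fun v hv => congrArg Finset.card (hindepSet v hv)] at h1
    have hsum : ∑ v ∈ I, Q.degree v = d + (k - 2) * k := by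
      have : ∑ v ∈ I, Q.degree v = ∑ v with l v = .special, Q.degree v +
          ∑ v with l v = .indep, Q.degree v := by
        rw [← Finset.sum_union, ← Finset.filter_or]
        exact Finset.disjoint_filter.2 fun a _ h h' => by simp [h] at h'
      rw [this, hv₀, Finset.sum_singleton, hspecial v₀ hv₀',
        Finset.sum_congr rfl fun v hv => hindep v (Finset.mem_filter.1 hv).2, Finset.sum_const, hc]
      rfl
    have h2 := two_mul_shapeSize n k d
    simp only [Finset.card_empty, Finset.sum_const_zero, smul_eq_mul, hsum] at h1
    omega

/-! ### The upper bound and its equality case -/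

variable {S : Finset V} {v₀ : V}

/-- The equality case of the size bound: an independent set `S` of `k - 1` vertices, of degrees `d`
(once) and `k` (otherwise), whose complement is a clique. That at most `k` vertices have degree
above `n - k` forces all the neighbourhoods of vertices of `S` into one set of `k` vertices. -/
lemma hasShape_of_extremal (hV : Fintype.card V = n) (hk : 3 ≤ k) (hkn : 2 * k ≤ n)
    (hv₀ : v₀ ∈ S) (hS : S.card = k - 1) (hdeg₀ : Q.degree v₀ = d)
    (hdeg : ∀ s ∈ S.erase v₀, Q.degree s = k)
    (hindep : ∀ s ∈ S, (S.filter (Q.Adj s)).card = 0)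
    (hclique : ∀ w ∈ Sᶜ, (Sᶜ.filter (Q.Adj w)).card = n - k)
    (hhigh : n - k ≤ (Finset.univ.filter fun v => Q.degree v ≤ n - k).card) :
    HasShape n k d Q := by
  have hSS : ∀ a ∈ S, ∀ b ∈ S, ¬ Q.Adj a b := by
    intro a ha b hb hab
    have := Finset.card_eq_zero.1 (hindep a ha)
    exact Finset.notMem_empty b (this ▸ Finset.mem_filter.2 ⟨hb, hab⟩)
  have hScard : Sᶜ.card = n - k + 1 := by
    rw [Finset.card_compl]
    omega
  have hcc : ∀ a, a ∉ S → ∀ b, b ∉ S → a ≠ b → Q.Adj a b := by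
    intro a ha b hb hab
    have ha' := Finset.mem_compl.2 ha
    have hsub : Sᶜ.filter (Q.Adj a) ⊆ Sᶜ.erase a := by
      intro x hx
      rw [Finset.mem_filter] at hx
      exact Finset.mem_erase.2 ⟨hx.2.ne', hx.1⟩
    have heq := Finset.eq_of_subset_of_card_le hsub (by
      rw [hclique a ha', Finset.card_erase_of_mem ha', hScard, Nat.add_sub_cancel])
    have hb' : b ∈ Sᶜ.erase a := Finset.mem_erase.2 ⟨hab.symm, Finset.mem_compl.2 hb⟩
    rw [← heq] at hb'
    exact (Finset.mem_filter.1 hb').2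
  let T := S.biUnion fun s => Q.neighborFinset s
  have hTS : ∀ w ∈ T, w ∉ S := by
    intro w hw hwS
    obtain ⟨s, hs, hsw⟩ := Finset.mem_biUnion.1 hw
    exact hSS s hs w hwS (by simpa using hsw)
  have hTcard : T.card ≤ k := by
    have hsub : T ⊆ (Finset.univ.filter fun v => Q.degree v ≤ n - k)ᶜ := by
      intro w hw
      have h1 := degree_eq_card_add_card_compl Q S w
      rw [hclique w (Finset.mem_compl.2 (hTS w hw))] at h1
      obtain ⟨s, hs, hsw⟩ := Finset.mem_biUnion.1 hw
      have h2 : 0 < (S.filter (Q.Adj w)).card :=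
        Finset.card_pos.2 ⟨s, Finset.mem_filter.2 ⟨hs, (show Q.Adj s w by simpa using hsw).symm⟩⟩
      simp only [Finset.mem_compl, Finset.mem_filter, Finset.mem_univ, true_and]
      omega
    have := Finset.card_le_card hsub
    rw [Finset.card_compl] at this
    omega
  have hNT : ∀ s ∈ S, Q.neighborFinset s ⊆ T := fun s hs =>
    Finset.subset_biUnion_of_mem (fun s => Q.neighborFinset s) hs
  have hNeq : ∀ s ∈ S.erase v₀, Q.neighborFinset s = T := fun s hs =>
    Finset.eq_of_subset_of_card_le (hNT s (Finset.mem_of_mem_erase hs))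
      (by rwa [card_neighborFinset_eq_degree, hdeg s hs])
  have hScard' : (S.erase v₀).card = k - 2 := by
    rw [Finset.card_erase_of_mem hv₀]
    omega
  have hTk : T.card = k := by
    obtain ⟨s, hs⟩ : (S.erase v₀).Nonempty := Finset.card_pos.1 (by omega)
    rw [← hNeq s hs, card_neighborFinset_eq_degree, hdeg s hs]
  have hST : ∀ s ∈ S, s ≠ v₀ → ∀ w, Q.Adj s w ↔ w ∈ T := by
    intro s hs hs₀ w
    rw [← hNeq s (Finset.mem_erase.2 ⟨hs₀, hs⟩), mem_neighborFinset]
  have hv₀T : ∀ w, Q.Adj v₀ w → w ∈ T := fun w hw => hNT v₀ hv₀ (by simpa using hw)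
  let l : V → Part := fun w =>
    if w = v₀ then .special else if w ∈ S then .indep else
      if Q.Adj v₀ w then .near else if w ∈ T then .far else .rest
  refine ⟨l, ?_, ?_⟩
  · intro a b
    have := Q.adj_comm a b
    have hne : Q.Adj a b → a ≠ b := fun h => h.ne
    by_cases hab : a = b
    · subst hab
      simp
    simp only [l]
    split_ifs <;> simp only [Part.Joined, ne_eq, hab, not_false_eq_true, and_true,
      and_false, iff_true, iff_false] <;> grind
  · intro p
    cases p
    · refine Eq.trans (congrArg Finset.card ?_) (Finset.card_singleton v₀)
      ext w
      simp only [l, Finset.mem_filter, Finset.mem_univ, true_and, Finset.mem_singleton]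
      split_ifs <;> simp_all
    · refine Eq.trans (congrArg Finset.card ?_) hScard'
      ext w
      simp only [l, Finset.mem_filter, Finset.mem_univ, true_and, Finset.mem_erase]
      split_ifs <;> simp_all
    · refine Eq.trans (congrArg Finset.card ?_) ((Q.card_neighborFinset_eq_degree v₀).trans hdeg₀)
      ext w
      simp only [l, Finset.mem_filter, Finset.mem_univ, true_and, mem_neighborFinset]
      split_ifs <;> grind
    · have : (T \ Q.neighborFinset v₀).card = k - d := by
        rw [Finset.card_sdiff_of_subset (hNT v₀ hv₀), hTk, card_neighborFinset_eq_degree, hdeg₀]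
      refine Eq.trans (congrArg Finset.card ?_) this
      ext w
      simp only [l, Finset.mem_filter, Finset.mem_univ, true_and, Finset.mem_sdiff,
        mem_neighborFinset]
      split_ifs <;> grind
    · have : (Sᶜ \ T).card = n - 2 * k + 1 := by
        rw [Finset.card_sdiff_of_subset fun w hw => Finset.mem_compl.2 (hTS w hw), hScard, hTk]
        omega
      refine Eq.trans (congrArg Finset.card ?_) this
      ext w
      simp only [l, Finset.mem_filter, Finset.mem_univ, true_and, Finset.mem_sdiff,
        Finset.mem_compl]
      split_ifs <;> grind

/-- The size bound, for some `k` from Berge's condition: `S` consists of `k - 1` vertices of degree at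
most `k`, among them one of minimum degree. -/
lemma exists_ncard_edgeSet_le_shapeSize (hd : 3 ≤ d) (hQ : IsAdmissible n d Q) :
    ∃ k, d ≤ k ∧ k ≤ n / 2 ∧ Q.edgeSet.ncard ≤ shapeSize n k d ∧
      (Q.edgeSet.ncard = shapeSize n k d → HasShape n k d Q) := by
  obtain ⟨hV, hmin, hham⟩ := hQ
  obtain ⟨k, hdk, hkn, hlow, hhigh⟩ := exists_degree_obstruction Q hham
  rw [hmin] at hdk
  rw [hV] at hkn hhigh
  have : Nonempty V := Fintype.card_pos_iff.1 (by omega)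
  obtain ⟨v₀, hv₀⟩ := Q.exists_minimal_degree_vertex
  have hdeg₀ : Q.degree v₀ = d := hv₀.symm.trans hmin
  obtain ⟨S, hS₀, hSlow, hS⟩ := Finset.exists_subsuperset_card_eq
    (s := {v₀}) (t := Finset.univ.filter fun v => Q.degree v ≤ k) (n := k - 1)
    (by simp [hdeg₀, hdk]) (by rw [Finset.card_singleton]; omega) (by omega)
  rw [Finset.singleton_subset_iff] at hS₀
  have hScard : Sᶜ.card = n - k + 1 := by
    rw [Finset.card_compl]
    omega
  have hle : ∀ s ∈ S.erase v₀, Q.degree s ≤ k := fun s hs =>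
    (Finset.mem_filter.1 (hSlow (Finset.mem_of_mem_erase hs))).2
  have hle' : ∀ w ∈ Sᶜ, (Sᶜ.filter (Q.Adj w)).card ≤ n - k := by
    intro w hw
    have hsub : Sᶜ.filter (Q.Adj w) ⊆ Sᶜ.erase w := by
      intro x hx
      rw [Finset.mem_filter] at hx
      exact Finset.mem_erase.2 ⟨hx.2.ne', hx.1⟩
    refine (Finset.card_le_card hsub).trans ?_
    rw [Finset.card_erase_of_mem hw, hScard]
    omega
  have hsum := Finset.sum_le_sum hle
  have hsum' := Finset.sum_le_sum hle'
  have hconst : ∑ _s ∈ S.erase v₀, k = (k - 2) * k := by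
    rw [Finset.sum_const, Finset.card_erase_of_mem hS₀, hS, smul_eq_mul, Nat.sub_sub]
  have hconst' : ∑ _w ∈ Sᶜ, (n - k) = (n - k + 1) * (n - k) := by
    rw [Finset.sum_const, hScard, smul_eq_mul]
  have hcount := two_mul_ncard_edgeSet_add Q S
  rw [← Finset.add_sum_erase S _ hS₀, ← Finset.add_sum_erase S (fun v => Q.degree v) hS₀, hdeg₀,
    Finset.add_sum_erase S (fun v => (S.filter (Q.Adj v)).card) hS₀] at hcount
  have hsize := two_mul_shapeSize n k d
  refine ⟨k, hdk, by omega, by omega, fun heq => ?_⟩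
  refine hasShape_of_extremal hV (by omega) hkn hS₀ hS hdeg₀ ?_ ?_ ?_ hhigh
  · exact (Finset.sum_eq_sum_iff_of_le hle).1 (by omega)
  · exact Finset.sum_eq_zero_iff.1 (by omega)
  · exact (Finset.sum_eq_sum_iff_of_le hle').1 (by omega)

/-! ### Comparison of the sizes -/

/-- In terms of `k`, twice the size of a graph of shape `(n, k, d)` is a convex quadratic
polynomial. -/
lemma two_mul_shapeSize_cast {n k : ℕ} (d : ℕ) (hk : 2 ≤ k) (hkn : k ≤ n) :
    2 * (shapeSize n k d : ℤ) = 3 * k ^ 2 - (2 * n + 5) * k + (n ^ 2 + n + 2 * d) := by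
  have := two_mul_shapeSize n k d
  zify [hk, hkn] at this
  rw [this]
  ring

/-- By strict convexity, only the ends `k = d` and `k = ⌊n/2⌋` of the range can be maximal. -/
lemma shapeSize_lt_max {n k d : ℕ} (hd : 2 ≤ d) (hdk : d < k) (hkn : k < n / 2) :
    shapeSize n k d < max (shapeSize n d d) (shapeSize n (n / 2) d) := by
  have h1 := two_mul_shapeSize_cast (n := n) (k := d) d hd (by omega)
  have h2 := two_mul_shapeSize_cast (n := n) (k := k) d (by omega) (by omega)
  have h3 := two_mul_shapeSize_cast (n := n) (k := n / 2) d (by omega) (by omega)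
  rw [lt_max_iff]
  by_contra! hcon
  generalize n / 2 = t at *
  obtain ⟨c1, c2⟩ := hcon
  zify at hdk hkn c1 c2
  nlinarith [mul_nonneg (sub_nonneg.2 hkn.le) (sub_nonneg.2 c1),
    mul_nonneg (sub_nonneg.2 hdk.le) (sub_nonneg.2 c2),
    mul_pos (mul_pos (sub_pos.2 hkn) (sub_pos.2 hdk)) (sub_pos.2 (hdk.trans hkn))]

lemma two_mul_shapeSize_sub (n d : ℕ) (hd : 2 ≤ d) (hdn : d ≤ n / 2) :
    2 * (shapeSize n d d : ℤ) - 2 * shapeSize n (n / 2) d =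
      ((n / 2 : ℕ) - d) * (2 * n + 5 - 3 * ((n / 2 : ℕ) + d)) := by
  rw [two_mul_shapeSize_cast d hd (by omega), two_mul_shapeSize_cast d (by omega) (by omega)]
  ring

end

/-! ### The maximum size and the graphs attaining it -/

lemma hasShape_iff_nonempty_iso_F {V : Type*} [Fintype V] {n k : ℕ} (hk : 2 ≤ k)
    {Q : SimpleGraph V} : HasShape n k k Q ↔ Nonempty (Q ≃g F n k) :=
  ⟨fun h => h.nonempty_iso (hasShape_F n k hk), fun ⟨e⟩ => (hasShape_F n k hk).of_iso e⟩

lemma hasShape_iff_nonempty_iso_G {V : Type*} [Fintype V] {n d : ℕ} (hd : 2 ≤ d)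
    (hdn : d ≤ n / 2) {Q : SimpleGraph V} :
    HasShape n (n / 2) d Q ↔ Nonempty (Q ≃g G n d) :=
  ⟨fun h => h.nonempty_iso (hasShape_G n d hd hdn), fun ⟨e⟩ => (hasShape_G n d hd hdn).of_iso e⟩

lemma shapeSize_mem_sizes {W : Type*} [Fintype W] {n k d : ℕ} {H : SimpleGraph W}
    (hH : HasShape n k d H) (hdk : d ≤ k) (hk : 2 ≤ k) (hkn : 2 * k ≤ n) :
    shapeSize n k d ∈ sizes n d := by
  let e := (Fintype.equivFinOfCardEq (hH.card_eq hdk hk hkn)).symm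
  have h := hH.of_iso (Iso.comap e H)
  exact ⟨_, h.isAdmissible_and_ncard hdk hk hkn⟩

lemma ncard_edgeSet_le_max {V : Type*} [Fintype V] {n d : ℕ} {Q : SimpleGraph V} (hd : 3 ≤ d)
    (hQ : IsAdmissible n d Q) :
    Q.edgeSet.ncard ≤ max (shapeSize n d d) (shapeSize n (n / 2) d) := by
  obtain ⟨k, hdk, hkn, hle, -⟩ := exists_ncard_edgeSet_le_shapeSize hd hQ
  rcases hdk.eq_or_lt with rfl | hdk
  · exact hle.trans (le_max_left _ _)
  rcases hkn.eq_or_lt with rfl | hkn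
  · exact hle.trans (le_max_right _ _)
  exact hle.trans (shapeSize_lt_max (by omega) hdk hkn).le

lemma isGreatest_max_shapeSize {n d : ℕ} (hd : 3 ≤ d) (hdn : d ≤ n / 2) :
    IsGreatest (sizes n d) (max (shapeSize n d d) (shapeSize n (n / 2) d)) := by
  constructor
  · rcases max_choice (shapeSize n d d) (shapeSize n (n / 2) d) with h | h <;> rw [h]
    · exact shapeSize_mem_sizes (hasShape_F n d (by omega)) le_rfl (by omega) (by omega)
    · exact shapeSize_mem_sizes (hasShape_G n d (by omega) hdn) hdn (by omega) (by omega)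
  · rintro m ⟨Q, hQ, rfl⟩
    exact ncard_edgeSet_le_max hd hQ

lemma phi_eq_max {n d : ℕ} (hd : 3 ≤ d) (hdn : d ≤ n / 2) :
    phi n d = max (shapeSize n d d) (shapeSize n (n / 2) d) :=
  (isGreatest_max_shapeSize hd hdn).csSup_eq

lemma attains_iff {V : Type*} [Fintype V] {n d : ℕ} {Q : SimpleGraph V} (hd : 3 ≤ d)
    (hdn : d ≤ n / 2) :
    Attains n d Q ↔
      (shapeSize n (n / 2) d ≤ shapeSize n d d ∧ Nonempty (Q ≃g F n d)) ∨
        (shapeSize n d d ≤ shapeSize n (n / 2) d ∧ Nonempty (Q ≃g G n d)) := by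
  rw [← hasShape_iff_nonempty_iso_F (by omega), ← hasShape_iff_nonempty_iso_G (by omega) hdn,
    Attains, phi_eq_max hd hdn]
  constructor
  · rintro ⟨hQ, hcard⟩
    obtain ⟨k, hdk, hkn, hle, heq⟩ := exists_ncard_edgeSet_le_shapeSize hd hQ
    rw [hcard] at hle heq
    rcases hdk.eq_or_lt with rfl | hdk
    · have h := (le_max_right _ _).trans hle
      exact Or.inl ⟨h, heq (max_eq_left h)⟩
    rcases hkn.eq_or_lt with rfl | hkn
    · have h := (le_max_left _ _).trans hle
      exact Or.inr ⟨h, heq (max_eq_right h)⟩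
    exact absurd hle (shapeSize_lt_max (by omega) hdk hkn).not_ge
  · rintro (⟨h, hQ⟩ | ⟨h, hQ⟩)
    · rw [max_eq_left h]
      exact hQ.isAdmissible_and_ncard le_rfl (by omega) (by omega)
    · rw [max_eq_right h]
      exact hQ.isAdmissible_and_ncard hdn (by omega) (by omega)

/-- When `d = ⌊n/2⌋`, no edge is deleted in the definition of `G n d`. -/
lemma nonempty_iso_F_iff_of_eq {V : Type*} [Fintype V] {n d : ℕ} {Q : SimpleGraph V}
    (hd : 2 ≤ d) (h : d = n / 2) : Nonempty (Q ≃g F n d) ↔ Nonempty (Q ≃g G n d) := by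
  rw [← hasShape_iff_nonempty_iso_F hd, ← hasShape_iff_nonempty_iso_G hd h.le, ← h]

lemma shapeSize_self (n d : ℕ) (hd : 2 ≤ d) :
    shapeSize n d d = (n - d + 1).choose 2 + d * (d - 1) := by
  obtain ⟨c, rfl⟩ := Nat.exists_eq_add_of_le hd
  simp only [shapeSize, Nat.add_sub_cancel_left, show 2 + c - 1 = c + 1 by omega]
  ring

end HamConn

theorem theorem2 (n δ : ℕ) (hδ : 3 ≤ δ) (hδn : δ ≤ n / 2) :
    -- the maximum exists
    IsGreatest (HamConn.sizes n δ) (HamConn.phi n δ) ∧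
    -- its value
    ((Odd n ∧ (δ : ℚ) ≤ ((n : ℚ) + 13) / 6 ∨ Even n ∧ (δ : ℚ) ≤ ((n : ℚ) + 10) / 6) →
      HamConn.phi n δ = (n - δ + 1).choose 2 + δ * (δ - 1)) ∧
    ((Odd n ∧ ((n : ℚ) + 13) / 6 ≤ (δ : ℚ) ∧ (δ : ℚ) ≤ ((n : ℚ) - 1) / 2) →
      (HamConn.phi n δ : ℚ) = (3 * (n : ℚ) ^ 2 - 8 * (n : ℚ) + 13) / 8 + (δ : ℚ)) ∧
    ((Even n ∧ ((n : ℚ) + 10) / 6 ≤ (δ : ℚ) ∧ (δ : ℚ) ≤ (n : ℚ) / 2) →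
      (HamConn.phi n δ : ℚ) = (3 * (n : ℚ) ^ 2 - 6 * (n : ℚ)) / 8 + (δ : ℚ)) ∧
    -- the extremal graphs
    (((δ : ℚ) = ((n : ℚ) + 13) / 6 ∨ (δ : ℚ) = ((n : ℚ) + 10) / 6) →
      ∀ (V : Type*) [Fintype V] (Q : SimpleGraph V), HamConn.Attains n δ Q ↔
        (Nonempty (Q ≃g HamConn.F n δ) ∨ Nonempty (Q ≃g HamConn.G n δ))) ∧
    ((Odd n ∧ (δ : ℚ) ≤ ((n : ℚ) + 11) / 6 ∨ Even n ∧ (δ : ℚ) ≤ ((n : ℚ) + 8) / 6) →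
      ∀ (V : Type*) [Fintype V] (Q : SimpleGraph V), HamConn.Attains n δ Q ↔
        Nonempty (Q ≃g HamConn.F n δ)) ∧
    ((Odd n ∧ ((n : ℚ) + 15) / 6 ≤ (δ : ℚ) ∧ (δ : ℚ) ≤ ((n : ℚ) - 1) / 2 ∨
        Even n ∧ ((n : ℚ) + 12) / 6 ≤ (δ : ℚ) ∧ (δ : ℚ) ≤ (n : ℚ) / 2) →
      ∀ (V : Type*) [Fintype V] (Q : SimpleGraph V), HamConn.Attains n δ Q ↔
        Nonempty (Q ≃g HamConn.G n δ)) := by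
  have hphi := HamConn.phi_eq_max hδ hδn
  have hsub := HamConn.two_mul_shapeSize_sub n δ (by omega) hδn
  have hsize := HamConn.two_mul_shapeSize_cast (n := n) (k := n / 2) δ (by omega) (by omega)
  -- The sign of the second factor in `hsub` compares the two sizes.
  have hF : 3 * (n / 2 + δ) ≤ 2 * n + 5 →
      HamConn.shapeSize n (n / 2) δ ≤ HamConn.shapeSize n δ δ := by
    intro h
    zify at h hδn ⊢
    push_cast at hsub
    nlinarith [mul_nonneg (sub_nonneg.2 hδn) (sub_nonneg.2 h)]
  have hG : 2 * n + 5 ≤ 3 * (n / 2 + δ) →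
      HamConn.shapeSize n δ δ ≤ HamConn.shapeSize n (n / 2) δ := by
    intro h
    zify at h hδn ⊢
    push_cast at hsub
    nlinarith [mul_nonneg (sub_nonneg.2 hδn) (sub_nonneg.2 h)]
  have hF' : 3 * (n / 2 + δ) < 2 * n + 5 → δ < n / 2 →
      HamConn.shapeSize n (n / 2) δ < HamConn.shapeSize n δ δ := by
    intro h h'
    zify at h h' ⊢
    push_cast at hsub
    nlinarith [mul_pos (sub_pos.2 h') (sub_pos.2 h)]
  have hG' : 2 * n + 5 < 3 * (n / 2 + δ) → δ < n / 2 →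
      HamConn.shapeSize n δ δ < HamConn.shapeSize n (n / 2) δ := by
    intro h h'
    zify at h h' ⊢
    push_cast at hsub
    nlinarith [mul_pos (sub_pos.2 h') (sub_pos.2 h)]
  have hle : ∀ c : ℕ, (δ : ℚ) ≤ ((n : ℚ) + c) / 6 ↔ δ * 6 ≤ n + c := fun c => by
    rw [le_div_iff₀ (by norm_num)]
    norm_cast
  have hge : ∀ c : ℕ, ((n : ℚ) + c) / 6 ≤ (δ : ℚ) ↔ n + c ≤ δ * 6 := fun c => by
    rw [div_le_iff₀ (by norm_num)]
    norm_cast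
  have heq : ∀ c : ℕ, (δ : ℚ) = ((n : ℚ) + c) / 6 ↔ δ * 6 = n + c := fun c => by
    rw [eq_div_iff (by norm_num)]
    norm_cast
  have hle13 := hle 13
  have hle10 := hle 10
  have hle11 := hle 11
  have hle8 := hle 8
  have hge13 := hge 13
  have hge10 := hge 10
  have hge15 := hge 15
  have hge12 := hge 12
  have heq13 := heq 13
  have heq10 := heq 10
  clear hle hge heq
  simp only [Nat.cast_ofNat] at *
  simp only [hle13, hle10, hle11, hle8, hge13, hge10, hge15, hge12, heq13, heq10, Nat.odd_iff,
    Nat.even_iff]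
  refine ⟨hphi ▸ HamConn.isGreatest_max_shapeSize hδ hδn, ?_, ?_, ?_, ?_, ?_, ?_⟩
  · intro h
    rw [hphi, max_eq_left (hF (by omega)), HamConn.shapeSize_self n δ (by omega)]
  · rintro ⟨hn, h, -⟩
    rw [hphi, max_eq_right (hG (by omega))]
    obtain ⟨t, ht⟩ : ∃ t, n / 2 = t := ⟨_, rfl⟩
    obtain rfl : n = 2 * t + 1 := by omega
    rw [ht] at hsize ⊢
    have := congrArg (Int.cast : ℤ → ℚ) hsize
    push_cast at this ⊢
    linarith
  · rintro ⟨hn, h, -⟩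
    rw [hphi, max_eq_right (hG (by omega))]
    obtain ⟨t, ht⟩ : ∃ t, n / 2 = t := ⟨_, rfl⟩
    obtain rfl : n = 2 * t := by omega
    rw [ht] at hsize ⊢
    have := congrArg (Int.cast : ℤ → ℚ) hsize
    push_cast at this ⊢
    linarith
  · intro h V _ Q
    rw [HamConn.attains_iff hδ hδn]
    have h1 := hF (by omega)
    have h2 := hG (by omega)
    simp only [h1, h2, true_and]
  · intro h V _ Q
    rw [HamConn.attains_iff hδ hδn]
    have h1 := hF (by omega)
    rcases hδn.eq_or_lt with he | hlt
    · rw [← HamConn.nonempty_iso_F_iff_of_eq (by omega) he]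
      simp only [h1, true_and]
      exact or_iff_left_of_imp And.right
    · have h2 := (hF' (by omega) hlt).not_ge
      simp only [h1, h2, true_and, false_and, or_false]
  · intro h V _ Q
    rw [HamConn.attains_iff hδ hδn]
    have h1 := hG (by omega)
    rcases hδn.eq_or_lt with he | hlt
    · rw [HamConn.nonempty_iso_F_iff_of_eq (by omega) he]
      simp only [h1, true_and]
      exact or_iff_right_of_imp And.right
    · have h2 := (hG' (by omega) hlt).not_ge
      simp only [h1, h2, true_and, false_and, false_or]
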